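/- A (finite) cycle set is a finite set $X$ with a binary operation $\cdot$ such that $(x\cdot y)\cdot(x\cdot z)=(y\cdot x)\cdot(y\cdot z)$ for all $x,y,z\in X$, such that every map $\sigma_x\colon X\to X$, $y\mapsto x\cdot y$, is bijective, and such that $x\mapsto x\cdot x$ is bijective. It is indecomposable if it is not a disjoint union of two non-empty subsets that are closed under the operation. Its retraction $\mathrm{Ret}(X)$ is the cycle set of classes of $X$ under the relation $x\sim y\Leftrightarrow\sigma_x=\sigma_y$, with the induced operation, and $X$ has multipermutation level $k$ if $k\ge 0$ is the smallest integer with $|\mathrm{Ret}^k(X)|=1$. Homomorphisms and isomorphisms are defined in the obvious way. Let $m\geq 1$ and write $\mathbb{Z}_m=\mathbb{Z}/m\mathbb{Z}$. For $b\in\mathbb{Z}_m$ put $\chi_0(b)=1$ if $b=0$ and $\chi_0(b)=0$ otherwise. For a finite abelian group $A$, a map $\Phi\colon\mathbb{Z}_m\to A$ and $S\in A$, let $X(A,\Phi,S)$ be the cycle set $\mathbb{Z}_m\times A$ with $$(a,x)\cdot(b,y)=(b+1,\;y+\chi_0(b)S+\Phi(b-a)).$$ **Theorem.** (1) Every indecomposable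 cycle set $X$ of multipermutation level $2$ with $|\mathrm{Ret}(X)|=m$ is isomorphic to $X(A,\Phi,S)$ for some finite abelian group $A$, some non-constant map $\Phi\colon\mathbb{Z}_m\to A$ with $\Phi(0)=0$, and some $S\in A$. (2) Let $A,B$ be finite abelian groups, let $\Phi\colon\mathbb{Z}_m\to A$ and $\Phi'\colon\mathbb{Z}_m\to B$ be non-constant maps with $\Phi(0)=0$ and $\Phi'(0)=0$, and let $S\in A$, $S'\in B$, such that $X(A,\Phi,S)$ and $X(B,\Phi',S')$ are indecomposable. Then $X(A,\Phi,S)$ and $X(B,\Phi',S')$ are isomorphic if and only if there is a group isomorphism $f\colon A\to B$ with $\Phi'=f\circ\Phi$ and $f(S)=S'$. -/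

import Mathlib

universe u v w

/-- A (finite, non-degenerate) cycle set: a finite set with a binary operation `x ⬝ y = dot x y`
such that `(x ⬝ y) ⬝ (x ⬝ z) = (y ⬝ x) ⬝ (y ⬝ z)`, every left translation `y ↦ x ⬝ y` is
bijective, and the square map `x ↦ x ⬝ x` is bijective. -/
class CycleSet (X : Type u) where
  dot : X → X → X
  finite : Finite X
  dot_dot : ∀ x y z, dot (dot x y) (dot x z) = dot (dot y x) (dot y z)
  bijective_dot : ∀ x, Function.Bijective (dot x)
  bijective_sq : Function.Bijective fun x => dot x x

namespace CycleSet

/-- Isomorphism of cycle sets: a bijection compatible with the operations. -/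
def Isomorphic (X : Type u) (Y : Type v) [CycleSet X] [CycleSet Y] : Prop :=
  ∃ e : X ≃ Y, ∀ x y, e (dot x y) = dot (e x) (e y)

/-- A subset closed under the cycle set operation. -/
def IsClosedSubset {X : Type u} [CycleSet X] (T : Set X) : Prop :=
  ∀ x ∈ T, ∀ y ∈ T, dot x y ∈ T

/-- `X` is indecomposable if it is not the disjoint union of two non-empty subsets that are closed
under the operation. -/
def Indecomposable (X : Type u) [CycleSet X] : Prop :=
  ¬ ∃ X₁ X₂ : Set X, X₁.Nonempty ∧ X₂.Nonempty ∧ Disjoint X₁ X₂ ∧ X₁ ∪ X₂ = Set.univ ∧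
    IsClosedSubset X₁ ∧ IsClosedSubset X₂

/-- The retract relation: `x` and `y` have the same left translation. -/
def retSetoid (X : Type u) [CycleSet X] : Setoid X where
  r x y := dot x = dot y
  iseqv := ⟨fun _ => rfl, fun h => h.symm, fun h h' => h.trans h'⟩

/-- The retraction `Ret(X)`: the set of classes of elements with equal left translation (that is,
the image of `x ↦ σ_x⁻¹`, up to the evident bijection). -/
def Ret (X : Type u) [CycleSet X] : Type u := Quotient (retSetoid X)

theorem dot_congr_of_ret {X : Type u} [CycleSet X] {x x' y y' : X}
    (hx : dot x = dot x') (hy : dot y = dot y') : dot (dot x y) = dot (dot x' y') := by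
  rw [← hx]
  funext w
  obtain ⟨z, rfl⟩ := (bijective_dot x).2 w
  rw [dot_dot, dot_dot x y' z, hy]

/-- The operation on `Ret(X)` is the one that makes `X → Ret(X)` a homomorphism. -/
instance instRet (X : Type u) [CycleSet X] : CycleSet (Ret X) where
  dot := Quotient.map₂ (sa := retSetoid X) (sb := retSetoid X) (sc := retSetoid X) dot
    fun _ _ hx _ _ hy => dot_congr_of_ret hx hy
  finite :=
    haveI : Finite X := finite
    inferInstanceAs (Finite (Quotient (retSetoid X)))
  dot_dot := by
    rintro ⟨x⟩ ⟨y⟩ ⟨z⟩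
    exact congrArg (Quotient.mk (retSetoid X)) (dot_dot x y z)
  bijective_dot := by
    have : Finite X := finite
    have : Finite (Quotient (retSetoid X)) := inferInstance
    rintro ⟨x⟩
    refine Function.Surjective.bijective_of_finite (α := Quotient (retSetoid X)) ?_
    rintro ⟨y⟩
    obtain ⟨z, rfl⟩ := (bijective_dot x).2 y
    exact ⟨Quotient.mk (retSetoid X) z, rfl⟩
  bijective_sq := by
    have : Finite X := finite
    have : Finite (Quotient (retSetoid X)) := inferInstance
    refine Function.Surjective.bijective_of_finite (α := Quotient (retSetoid X)) ?_
    rintro ⟨y⟩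
    obtain ⟨z, rfl⟩ := (bijective_sq (X := X)).2 y
    exact ⟨Quotient.mk (retSetoid X) z, rfl⟩

/-- The cardinality of the `k`-fold iterated retraction `Ret^k(X)`. -/
noncomputable def cardIterRet : ℕ → (X : Type u) → [CycleSet X] → ℕ
  | 0, X, _ => Nat.card X
  | k + 1, X, _ => cardIterRet k (Ret X)

/-- `X` has multipermutation level `k`: `k` is the smallest number with `|Ret^k(X)| = 1`. -/
def HasMultipermutationLevel (X : Type u) [CycleSet X] (k : ℕ) : Prop :=
  IsLeast {j : ℕ | cardIterRet j X = 1} k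

/-- `χ₀(x) = 1` if `x = 0` and `χ₀(x) = 0` otherwise. -/
def chi0 {A : Type u} [AddCommGroup A] [DecidableEq A] (x : A) : ℤ := if x = 0 then 1 else 0

/-- The set `ℤ_m × A` that carries the cycle set structure defined by `Φ` and `S`. -/
def CyclicExt (m : ℕ) (A : Type u) (_Φ : ZMod m → A) (_S : A) : Type u := ZMod m × A

/-- `(a, x) ⬝ (b, y) = (b + 1, y + χ₀(b) S + Φ(b - a))` on `ℤ_m × A`. -/
instance instCyclicExt (m : ℕ) [NeZero m] (A : Type u) [AddCommGroup A] [Finite A]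
    (Φ : ZMod m → A) (S : A) : CycleSet (CyclicExt m A Φ S) where
  dot p q := (q.1 + 1, q.2 + chi0 q.1 • S + Φ (q.1 - p.1))
  finite := inferInstanceAs (Finite (ZMod m × A))
  dot_dot := by
    rintro ⟨a, x⟩ ⟨b, y⟩ ⟨c, z⟩
    refine Prod.ext rfl ?_
    simp only [add_sub_add_right_eq_sub]
    abel
  bijective_dot := by
    rintro ⟨a, x⟩
    constructor
    · rintro ⟨b, y⟩ ⟨c, z⟩ h
      obtain rfl : b = c := add_right_cancel (congrArg Prod.fst h)
      have h2 := congrArg Prod.snd h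
      exact Prod.ext rfl (add_right_cancel (add_right_cancel h2))
    · rintro ⟨b, y⟩
      refine ⟨(b - 1, y - Φ (b - 1 - a) - chi0 (b - 1) • S), Prod.ext ?_ ?_⟩ <;> simp
  bijective_sq := by
    constructor
    · rintro ⟨b, y⟩ ⟨c, z⟩ h
      obtain rfl : b = c := add_right_cancel (congrArg Prod.fst h)
      have h2 := congrArg Prod.snd h
      exact Prod.ext rfl (add_right_cancel (add_right_cancel h2))
    · rintro ⟨b, y⟩
      refine ⟨(b - 1, y - Φ 0 - chi0 (b - 1) • S), Prod.ext ?_ ?_⟩ <;> simp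

end CycleSet

/-!
Both parts rest on the square map `q : x ↦ x ⬝ x` and on the fact that in an indecomposable cycle
set a non-empty subset stable under all left translations is everything
(`Indecomposable.eq_univ`).

*Existence.* If `X` has level two, then all left translations of `Ret(X)` are equal, and
indecomposability makes this permutation a single cycle. So `X` is graded by a map `π : X → ℤ_m`
with `π (x ⬝ y) = π y + 1` whose fibres are the retraction classes (`exists_grading`). The cycle set
identity then makes `q` an automorphism of degree one (`dot_sq`). The displacements
`t x = q⁻¹ σ_x` have degree zero, and the cycle set identity turns into `t x t y = t y t x`; they
also commute with `q ^ m`, because `t x` depends on `π x` only and `q` conjugates `t x` to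
`t (q x)`. Together they generate an abelian group `N`. If `x₀` has degree `0` and `A` is the
quotient of `N` by the stabilizer of `x₀`, then `(b, n) ↦ q ^ b n x₀` with `1 ≤ b ≤ m` is the
isomorphism wanted, where `S` is the class of `q ^ m` and `Φ j` that of `t x` for `π x = -j`
(`isomorphic_cyclicExt_of_mulAction`).

*Uniqueness.* An isomorphism between two such cycle sets shifts the `ℤ_m`-coordinate by a constant,
which powers of the square map reduce to `0` (`Isomorphic.exists_fst_eq`). On the fibre over `1`
it then intertwines translation by `S` and `Φ i` with translation by `S'` and `Φ' i`. By
indecomposability these elements generate `A` (`closure_eq_top_of_indecomposable`), so on this fibre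
the isomorphism is a group isomorphism followed by a translation.
-/

namespace CycleSet

open MulAction

/-! ### Indecomposability and the square map -/

/-- Since `X` is finite, a set stable under a left translation is also stable under its inverse, so
the complement of a set stable under all left translations is again closed. -/
theorem Indecomposable.eq_univ {X : Type u} [CycleSet X] (hX : Indecomposable X) {T : Set X}
    (hne : T.Nonempty) (hT : ∀ x, ∀ y ∈ T, dot x y ∈ T) : T = Set.univ := by
  by_contra h
  have : Finite X := finite
  refine hX ⟨T, Tᶜ, hne, Set.nonempty_compl.2 h, disjoint_compl_right, Set.union_compl_self T,
    fun x _ y hy => hT x y hy, fun x _ y hy hxy => hy ?_⟩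
  have hsurj : Set.SurjOn (dot x) T T := by
    have himg : dot x '' T ⊆ T := Set.image_subset_iff.2 (hT x)
    have := Set.eq_of_subset_of_ncard_le himg
      (Set.ncard_image_of_injective T (bijective_dot x).1).ge (Set.toFinite T)
    exact this.ge
  obtain ⟨z, hz, hzy⟩ := hsurj hxy
  exact (bijective_dot x).1 hzy ▸ hz

theorem Indecomposable.apply_eq_of_dot_invariant {X : Type u} [CycleSet X]
    (hX : Indecomposable X) {Z : Type*} (f : X → Z) (hf : ∀ x y, f (dot x y) = f y) (x y : X) :
    f x = f y := by
  have h : {z | f z = f y} = Set.univ :=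
    hX.eq_univ ⟨y, rfl⟩ fun z w hw => (hf z w).trans hw
  exact h.ge (Set.mem_univ x)

theorem Indecomposable.ret {X : Type u} [CycleSet X] (hX : Indecomposable X) :
    Indecomposable (Ret X) := by
  rintro ⟨T₁, T₂, ⟨⟨a⟩, ha⟩, ⟨⟨b⟩, hb⟩, hd, hu, h₁, h₂⟩
  let π : X → Ret X := Quotient.mk (retSetoid X)
  exact hX ⟨π ⁻¹' T₁, π ⁻¹' T₂, ⟨a, ha⟩, ⟨b, hb⟩, hd.preimage π,
    by rw [← Set.preimage_union, hu, Set.preimage_univ],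
    fun x hx y hy => h₁ _ hx _ hy, fun x hx y hy => h₂ _ hx _ hy⟩

/-- If `σ_{y ⬝ x}` depends on `x` only, then the square map is an endomorphism:
`(x ⬝ y) ⬝ (x ⬝ y) = (y ⬝ x) ⬝ (y ⬝ y) = (x ⬝ x) ⬝ (y ⬝ y)`. -/
theorem dot_sq {X : Type u} [CycleSet X] (h : ∀ x y z : X, dot (dot y x) = dot (dot z x))
    (x y : X) : dot (dot x y) (dot x y) = dot (dot x x) (dot y y) := by
  rw [dot_dot x y y, h x y x]

/-! ### Isomorphisms between the cycle sets `X(A, Φ, S)` -/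

section CyclicExt

variable {m : ℕ} [NeZero m] {A : Type v} [AddCommGroup A] [Finite A] {B : Type w}
  [AddCommGroup B] [Finite B] {Φ : ZMod m → A} {S : A} {Φ' : ZMod m → B} {S' : B}

theorem cyclicExt_dot (p q : CyclicExt m A Φ S) :
    dot p q = ((q.1 + 1, q.2 + chi0 q.1 • S + Φ (q.1 - p.1)) : ZMod m × A) := rfl

theorem closure_eq_top_of_indecomposable (h : Indecomposable (CyclicExt m A Φ S)) :
    AddSubgroup.closure (insert S (Set.range Φ)) = ⊤ := by
  set H := AddSubgroup.closure (insert S (Set.range Φ))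
  have hS : S ∈ H := AddSubgroup.subset_closure (Set.mem_insert _ _)
  have hΦ (i) : Φ i ∈ H := AddSubgroup.subset_closure (Set.mem_insert_of_mem _ ⟨i, rfl⟩)
  have hT : {p : CyclicExt m A Φ S | p.2 ∈ H} = Set.univ :=
    h.eq_univ ⟨((0, 0) : ZMod m × A), H.zero_mem⟩ fun p q hq =>
      H.add_mem (H.add_mem hq (H.zsmul_mem hS _)) (hΦ _)
  exact (AddSubgroup.eq_top_iff' H).2 fun y => hT.ge (Set.mem_univ ((0, y) : ZMod m × A))

theorem isomorphic_cyclicExt_of_addEquiv (f : A ≃+ B) (hΦ : Φ' = f ∘ Φ) (hS : f S = S') :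
    Isomorphic (CyclicExt m A Φ S) (CyclicExt m B Φ' S') := by
  refine ⟨(Equiv.refl (ZMod m)).prodCongr f.toEquiv, fun p q => ?_⟩
  refine Prod.ext rfl ?_
  change f (q.2 + chi0 q.1 • S + Φ (q.1 - p.1)) = f q.2 + chi0 q.1 • S' + Φ' (q.1 - p.1)
  rw [map_add, map_add, map_zsmul, hS, hΦ, Function.comp_apply]

/-- An isomorphism shifts the first coordinate by a constant, by indecomposability; precomposing
it with powers of the square map, which is an automorphism, makes this constant `0`. -/
theorem Isomorphic.exists_fst_eq (h : Indecomposable (CyclicExt m A Φ S))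
    (hiso : Isomorphic (CyclicExt m A Φ S) (CyclicExt m B Φ' S')) :
    ∃ e : CyclicExt m A Φ S ≃ CyclicExt m B Φ' S',
      (∀ p q, e (dot p q) = dot (e p) (e q)) ∧ ∀ p, (e p).1 = p.1 := by
  obtain ⟨e, he⟩ := hiso
  have hconst := h.apply_eq_of_dot_invariant (fun p => (e p).1 - p.1) fun p q => by
    rw [he, cyclicExt_dot, cyclicExt_dot]
    exact add_sub_add_right_eq_sub _ _ _
  let o : CyclicExt m A Φ S := ((0, 0) : ZMod m × A)
  have key (k : ℕ) : ∃ e' : CyclicExt m A Φ S ≃ CyclicExt m B Φ' S',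
      (∀ p q, e' (dot p q) = dot (e' p) (e' q)) ∧
        ∀ p, (e' p).1 = p.1 + ((e o).1 - o.1) + k := by
    induction k with
    | zero => exact ⟨e, he, fun p => by rw [← hconst p o]; simp⟩
    | succ k ih =>
      obtain ⟨e', h₁, h₂⟩ := ih
      refine ⟨(Equiv.ofBijective _ bijective_sq).trans e', fun p q => ?_, fun p => ?_⟩
      · simp only [Equiv.trans_apply, Equiv.ofBijective_apply]
        rw [dot_sq (fun _ _ _ => rfl), h₁]
      · simp only [Equiv.trans_apply, Equiv.ofBijective_apply]
        rw [h₂, cyclicExt_dot]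
        push_cast
        ring
  obtain ⟨e', h₁, h₂⟩ := key (-((e o).1 - o.1)).val
  exact ⟨e', h₁, fun p => by rw [h₂, ZMod.natCast_zmod_val, add_neg_cancel_right]⟩

theorem exists_addEquiv_of_isomorphic (h : Indecomposable (CyclicExt m A Φ S))
    (hΦ : ¬ ∃ c, ∀ i, Φ i = c) (hΦ0 : Φ 0 = 0) (hΦ'0 : Φ' 0 = 0)
    (hiso : Isomorphic (CyclicExt m A Φ S) (CyclicExt m B Φ' S')) :
    ∃ f : A ≃+ B, Φ' = f ∘ Φ ∧ f S = S' := by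
  obtain ⟨e, he, hfst⟩ := hiso.exists_fst_eq h
  let g (b : ZMod m) (y : A) : B := (e ((b, y) : ZMod m × A)).2
  have heg (b y) : e ((b, y) : ZMod m × A) = ((b, g b y) : ZMod m × B) :=
    Prod.ext (hfst _) rfl
  have hg (a b y) : g (b + 1) (y + chi0 b • S + Φ (b - a)) =
      g b y + chi0 b • S' + Φ' (b - a) :=
    congrArg Prod.snd ((he ((a, 0) : ZMod m × A) ((b, y) : ZMod m × A)).trans
      (congrArg₂ dot (heg a 0) (heg b y)))
  have hm : (1 : ZMod m) ≠ 0 := fun h10 => hΦ ⟨Φ 0, fun i => by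
    rw [show i = 0 by rw [← mul_one i, h10, mul_zero]]⟩
  have hsucc (b y) (hb : b ≠ 0) : g (b + 1) y = g b y := by
    simpa [chi0, hb, hΦ0, hΦ'0] using hg b b y
  have hgk (k : ℕ) (hk : k < m) (y) : g (k + 1) y = g 1 y := by
    induction k with
    | zero => simp
    | succ k ih =>
      rw [hsucc _ _ ?_]
      · push_cast
        exact ih (by omega)
      · rw [Ne, ZMod.natCast_eq_zero_iff]
        exact fun hd => by have := Nat.le_of_dvd (by omega) hd; omega
  have hg0 (y) : g 0 y = g 1 y := by
    have hpos : 0 < m := NeZero.pos m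
    have := hgk (m - 1) (by omega) y
    rwa [← Nat.cast_succ, Nat.succ_eq_add_one, Nat.sub_add_cancel hpos, ZMod.natCast_self] at this
  have hgS (y) : g 1 (y + S) = g 1 y + S' := by
    simpa [chi0, hΦ0, hΦ'0, hg0] using hg 0 0 y
  have hgΦ (i y) : g 1 (y + Φ i) = g 1 y + Φ' i := by
    have := hg (1 - i) 1 y
    rw [hsucc 1 _ hm] at this
    simpa [chi0, hm] using this
  -- The translations that `g 1` intertwines with translations form a subgroup of `A`, which
  -- contains the generators `S` and `Φ i`.
  have hadd (z y) : g 1 (y + z) = g 1 y + (g 1 z - g 1 0) := by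
    have hz : z ∈ AddSubgroup.closure (insert S (Set.range Φ)) :=
      (closure_eq_top_of_indecomposable h).ge trivial
    suffices H : ∃ d, ∀ y, g 1 (y + z) = g 1 y + d by
      obtain ⟨d, hd⟩ := H
      have h0 := hd 0
      rw [zero_add] at h0
      rw [hd, h0, add_sub_cancel_left]
    induction hz using AddSubgroup.closure_induction with
    | mem z hz =>
      obtain rfl | ⟨i, rfl⟩ := hz
      exacts [⟨S', hgS⟩, ⟨Φ' i, hgΦ i⟩]
    | zero => exact ⟨0, by simp⟩
    | add z w _ _ hz hw =>
      obtain ⟨d, hd⟩ := hz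
      obtain ⟨d', hd'⟩ := hw
      exact ⟨d + d', fun y => by rw [← add_assoc, hd', hd, add_assoc]⟩
    | neg z _ hz =>
      obtain ⟨d, hd⟩ := hz
      exact ⟨-d, fun y => by
        rw [← sub_eq_add_neg (g 1 y), eq_sub_iff_add_eq, ← hd, neg_add_cancel_right]⟩
  let F : A →+ B := AddMonoidHom.mk' (fun y => g 1 y - g 1 0) fun y z => by
    rw [hadd z y]; abel
  have hF : Function.Bijective F := by
    constructor
    · intro y z hyz
      have hyz' : g 1 y = g 1 z := sub_left_injective hyz
      have : e ((1, y) : ZMod m × A) = e ((1, z) : ZMod m × A) := by rw [heg, heg, hyz']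
      exact congrArg Prod.snd (e.injective this)
    · intro y
      obtain ⟨⟨b, z⟩, hz⟩ := e.surjective ((1, y + g 1 0) : ZMod m × B)
      have hb : b = 1 := (hfst _).symm.trans (congrArg Prod.fst hz)
      subst hb
      exact ⟨z, sub_eq_of_eq_add (congrArg Prod.snd hz)⟩
  refine ⟨AddEquiv.ofBijective F hF, funext fun i => ?_, ?_⟩
  · have := hgΦ i 0
    rw [zero_add] at this
    exact (sub_eq_of_eq_add' this).symm
  · have := hgS 0
    rw [zero_add] at this
    exact sub_eq_of_eq_add' this

end CyclicExt

/-! ### Cycle sets of multipermutation level two -/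

/-- A permutation of a set with `m` elements that has only one orbit is a cycle of length `m`. -/
theorem exists_equiv_zmod_of_transitive {R : Type*} [Finite R] [Nonempty R] (ρ : Equiv.Perm R)
    (hρ : ∀ T : Set R, T.Nonempty → (∀ x ∈ T, ρ x ∈ T) → T = Set.univ) :
    ∃ e : R ≃ ZMod (Nat.card R), ∀ x, e (ρ x) = e x + 1 := by
  obtain ⟨o⟩ := ‹Nonempty R›
  have horb : orbit (Subgroup.zpowers ρ) o = Set.univ := hρ _ ⟨o, mem_orbit_self o⟩
    fun x hx => mem_orbit_of_mem_orbit (⟨ρ, Subgroup.mem_zpowers ρ⟩ : Subgroup.zpowers ρ) hx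
  let e := ((Equiv.setCongr horb).trans (Equiv.Set.univ R)).symm.trans (orbitZPowersEquiv ρ o)
  have hcard : Nat.card R = Function.minimalPeriod (ρ • ·) o := by
    rw [Nat.card_congr e, Nat.card_zmod]
  have he (k : ℤ) : e.symm k = (ρ ^ k) o :=
    congrArg Subtype.val (orbitZPowersEquiv_symm_apply' ρ o k)
  rw [hcard]
  refine ⟨e, fun x => ?_⟩
  obtain ⟨k, hk⟩ := ZMod.intCast_surjective (e x)
  rw [← Equiv.eq_symm_apply, ← hk, ← Int.cast_one, ← Int.cast_add, he, add_comm,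
    zpow_add, zpow_one, Equiv.Perm.mul_apply, ← he, hk, e.symm_apply_apply]

theorem not_forall_dot_eq_of_level_two {X : Type u} [CycleSet X]
    (hX : HasMultipermutationLevel X 2) : ¬ ∀ x y : X, dot x = dot y := by
  intro h
  have h2 : Nat.card (Ret (Ret X)) = 1 := hX.1
  have hne : Nonempty (Ret (Ret X)) := (Nat.card_eq_one_iff_unique.1 h2).2
  obtain ⟨⟨⟨x⟩⟩⟩ := hne
  have h1 : Nat.card (Ret X) = 1 := Nat.card_eq_one_iff_unique.2 ⟨⟨by
    rintro ⟨y⟩ ⟨z⟩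
    exact Quotient.sound (h y z)⟩, ⟨Quotient.mk (retSetoid X) x⟩⟩
  have := hX.2 (show cardIterRet 1 X = 1 from h1)
  omega

/-- For an indecomposable cycle set of level two, the retraction is `ℤ_m` with the operation
`a ⬝ b = b + 1`. -/
theorem exists_grading {m : ℕ} {X : Type u} [CycleSet X] (hX : Indecomposable X)
    (hl : HasMultipermutationLevel X 2) (hm : Nat.card (Ret X) = m) :
    ∃ π : X → ZMod m, Function.Surjective π ∧ (∀ x y, π (dot x y) = π y + 1) ∧
      ∀ x y, π x = π y → dot x = dot y := by
  have h2 : Nat.card (Ret (Ret X)) = 1 := hl.1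
  obtain ⟨hsub, ⟨⟨o⟩⟩⟩ := Nat.card_eq_one_iff_unique.1 h2
  have hdot (r s : Ret X) : dot r = dot s := Quotient.exact (hsub.elim
    (Quotient.mk (retSetoid (Ret X)) r) (Quotient.mk (retSetoid (Ret X)) s))
  have : Finite (Ret X) := finite
  have : Nonempty (Ret X) := ⟨o⟩
  obtain ⟨e, he⟩ := exists_equiv_zmod_of_transitive (Equiv.ofBijective _ (bijective_dot o))
    fun T hne hT => hX.ret.eq_univ hne fun r s hs => hdot o r ▸ hT s hs
  subst hm
  refine ⟨fun x => e (Quotient.mk (retSetoid X) x), e.surjective.comp Quotient.mk_surjective,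
    fun x y => ?_, fun x y hxy => Quotient.exact (e.injective hxy)⟩
  have h := congrFun (hdot (Quotient.mk (retSetoid X) x) o) (Quotient.mk (retSetoid X) y)
  exact (congrArg e h).trans (he _)

theorem val_add_one_of_ne_zero {m : ℕ} [NeZero m] {c : ZMod m} (hc : c + 1 ≠ 0) :
    (c + 1).val = c.val + 1 := by
  have hlt : c.val + 1 < m := by
    refine lt_of_le_of_ne c.val_lt fun h => hc ?_
    rw [← ZMod.natCast_zmod_val c, ← Nat.cast_one, ← Nat.cast_add, h, ZMod.natCast_self]
  conv_lhs => rw [← ZMod.natCast_zmod_val c, ← Nat.cast_one, ← Nat.cast_add]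
  exact ZMod.val_natCast_of_lt hlt

theorem val_add_one_of_eq_zero {m : ℕ} [NeZero m] {c : ZMod m} (hc : c + 1 = 0) :
    c.val + 1 = m := by
  have hd : m ∣ c.val + 1 := by
    rw [← ZMod.natCast_eq_zero_iff, Nat.cast_add, ZMod.natCast_zmod_val, Nat.cast_one, hc]
  exact le_antisymm c.val_lt (Nat.le_of_dvd (Nat.succ_pos _) hd)

theorem apply_perm_pow_eq_add {X R : Type*} [AddCommGroupWithOne R] {q : Equiv.Perm X} {π : X → R}
    (h : ∀ x, π (q x) = π x + 1) (k : ℕ) (x : X) : π ((q ^ k) x) = π x + k := by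
  induction k with
  | zero => simp
  | succ k ih => rw [pow_succ', Equiv.Perm.mul_apply, h, ih, Nat.cast_succ, add_assoc]

theorem perm_pow_map₂ {X : Type*} {q : Equiv.Perm X} {F : X → X → X}
    (h : ∀ x y, q (F x y) = F (q x) (q y)) (k : ℕ) (x y : X) :
    (q ^ k) (F x y) = F ((q ^ k) x) ((q ^ k) y) := by
  induction k with
  | zero => rfl
  | succ k ih => simp only [pow_succ', Equiv.Perm.mul_apply, ih, h]

/-- Coordinates on `X`, given an abelian group `N` acting on the fibres of the grading `π` and
containing the displacements `t x = q⁻¹ σ_x` and the power `s = q ^ m` of the square map `q`. With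
`x₀` in the fibre over `0` and `A = N / N_{x₀}`, the point with coordinates `(b, n)` is
`q ^ b n x₀`, the exponent being the representative of `b` in `{1, …, m}`. -/
theorem isomorphic_cyclicExt_of_mulAction {m : ℕ} [NeZero m] {X : Type u} [CycleSet X]
    (hX : Indecomposable X) {π : X → ZMod m} (hsurj : Function.Surjective π)
    (hπ : ∀ x y, π (dot x y) = π y + 1) (hdot : ∀ x y, π x = π y → dot x = dot y)
    (q : Equiv.Perm X) (hq : ∀ x, q x = dot x x)
    {N : Type u} [CommGroup N] [Finite N] [MulAction N X] (hN : ∀ (n : N) x, π (n • x) = π x)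
    (t : X → N) (ht : ∀ x y, q (t x • y) = dot x y) (htq : ∀ x y, q (t x • y) = t (q x) • q y)
    (s : N) (hs : ∀ x, s • x = (q ^ m) x) :
    ∃ (A : Type u) (_ : AddCommGroup A) (_ : Finite A) (Φ : ZMod m → A) (S : A),
      Φ 0 = 0 ∧ Isomorphic X (CyclicExt m A Φ S) := by
  obtain ⟨x₀, hx₀⟩ := hsurj 0
  choose z hz using hsurj
  let r (b : ZMod m) : ℕ := (b - 1).val + 1
  have hr (b) : (r b : ZMod m) = b := by simp [r]
  have hπq (k : ℕ) (x) : π ((q ^ k) x) = π x + k :=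
    apply_perm_pow_eq_add (fun x => by rw [hq, hπ]) k x
  have htpow (k : ℕ) (x y) : (q ^ k) (t x • y) = t ((q ^ k) x) • (q ^ k) y :=
    perm_pow_map₂ (F := fun x y => t x • y) htq k x y
  have htπ (x x' y) (h : π x = π x') : t x • y = t x' • y :=
    q.injective (by rw [ht, ht, hdot x x' h])
  let Q := N ⧸ stabilizer N x₀
  let pt : Q → X := ofQuotientStabilizer N x₀
  have hpt (g) : π (pt g) = 0 := by
    induction g using QuotientGroup.induction_on with
    | H n => exact (hN n x₀).trans hx₀
  let Φ : ZMod m → Additive Q := fun j => .ofMul (QuotientGroup.mk (t (z (-j))))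
  let S : Additive Q := .ofMul (QuotientGroup.mk s)
  let E : CyclicExt m (Additive Q) Φ S → X := fun p => (q ^ r p.1) (pt p.2.toMul)
  have hπE (p) : π (E p) = p.1 := by
    change π ((q ^ r p.1) (pt p.2.toMul)) = p.1
    rw [hπq, hpt, hr, zero_add]
  have hE (p p') : E (dot p p') = dot (E p) (E p') := by
    have hEp := hπE p
    generalize E p = x at hEp
    obtain ⟨a, y⟩ := p
    obtain ⟨b, g⟩ := p'
    change π x = a at hEp
    induction g using QuotientGroup.induction_on with
    | H n =>
      have hright : dot x ((q ^ r b) (n • x₀)) =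
          (q ^ (r b + 1)) ((n * t (z (-(b - a)))) • x₀) := by
        rw [← ht, htπ x ((q ^ r b) (z (-(b - a)))) _ (by rw [hπq, hz, hr, hEp]; ring), ← htpow,
          mul_comm, mul_smul, pow_succ' q (r b), Equiv.Perm.mul_apply]
      change (q ^ r (b + 1)) (pt (Additive.toMul
        (Additive.ofMul (QuotientGroup.mk n : Q) + chi0 b • S + Φ (b - a)))) =
          dot x ((q ^ r b) (n • x₀))
      rw [hright]
      by_cases hb : b = 0
      · -- The step from `q ^ m` to `q ^ 1` is where the exponent wraps around.
        have h1 : r b + 1 = r (b + 1) + m := by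
          have : r b = m := val_add_one_of_eq_zero (by rw [hb]; ring)
          rw [this, hb]
          simp [r, add_comm]
        have h2 : chi0 b • S = S := by simp [chi0, hb]
        rw [h1, h2, pow_add q (r (b + 1)) m, Equiv.Perm.mul_apply, ← hs, ← mul_smul]
        change (q ^ r (b + 1)) ((n * s * t (z (-(b - a)))) • x₀) = _
        rw [mul_comm n s, mul_assoc]
      · have h1 : r (b + 1) = r b + 1 := by
          have := val_add_one_of_ne_zero (c := b - 1) (by simpa using hb)
          rw [sub_add_cancel] at this
          simp only [r, add_sub_cancel_right]
          rw [this]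
        have h2 : chi0 b • S = 0 := by simp [chi0, hb]
        rw [h1, h2, add_zero]
        rfl
  have hbij : Function.Bijective E := by
    constructor
    · intro p p' h
      have h1 : p.1 = p'.1 := by rw [← hπE, ← hπE, h]
      refine Prod.ext h1 (injective_ofQuotientStabilizer N x₀ ((q ^ r p.1).injective ?_))
      conv_rhs => rw [h1]
      exact h
    · rw [← Set.range_eq_univ]
      refine hX.eq_univ ⟨_, ⟨((0, 0) : ZMod m × Additive Q), rfl⟩⟩ ?_
      rintro x _ ⟨p, rfl⟩
      let p' : CyclicExt m (Additive Q) Φ S := ((π x, 0) : ZMod m × Additive Q)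
      exact ⟨dot p' p, by rw [hE, hdot (E p') x (hπE p')]⟩
  refine ⟨Additive Q, inferInstance, inferInstanceAs (Finite Q), Φ, S, ?_,
    (Equiv.ofBijective E hbij).symm, fun x y => ?_⟩
  · -- The displacement of a point in the fibre of `x₀` agrees with that of `x₀`, so it fixes `x₀`.
    have : t (z (-0)) ∈ stabilizer N x₀ := by
      rw [mem_stabilizer_iff]
      apply q.injective
      rw [ht, hq, hdot (z (-0)) x₀ (by rw [hz, hx₀, neg_zero])]
    exact congrArg Additive.ofMul ((QuotientGroup.eq_one_iff _).2 this)
  · rw [Equiv.symm_apply_eq]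
    have h := hE ((Equiv.ofBijective E hbij).symm x) ((Equiv.ofBijective E hbij).symm y)
    have h' (x) : E ((Equiv.ofBijective E hbij).symm x) = x :=
      (Equiv.ofBijective E hbij).apply_symm_apply x
    rw [h', h'] at h
    exact h.symm

open scoped IsMulCommutative in
theorem exists_isomorphic_cyclicExt {m : ℕ} [NeZero m] {X : Type u} [CycleSet X]
    (hX : Indecomposable X) (hl : HasMultipermutationLevel X 2) (hm : Nat.card (Ret X) = m) :
    ∃ (A : Type u) (_ : AddCommGroup A) (_ : Finite A) (Φ : ZMod m → A) (S : A),
      (¬ ∃ c, ∀ i, Φ i = c) ∧ Φ 0 = 0 ∧ Isomorphic X (CyclicExt m A Φ S) := by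
  obtain ⟨π, hsurj, hπ, hdot⟩ := exists_grading hX hl hm
  have hfin : Finite X := finite
  let q : Equiv.Perm X := Equiv.ofBijective _ bijective_sq
  have hq (x) : q x = dot x x := rfl
  have hqdot (x y) : q (dot x y) = dot (q x) (q y) :=
    dot_sq (fun x y z => hdot _ _ (by rw [hπ, hπ])) x y
  let t (x : X) : Equiv.Perm X := q⁻¹ * Equiv.ofBijective _ (bijective_dot x)
  have ht (x y) : q (t x y) = dot x y := q.apply_symm_apply _
  have htq (x y) : q (t x y) = t (q x) (q y) := q.injective (by rw [ht, ht, hqdot])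
  have htπ (x x') (h : π x = π x') : t x = t x' :=
    Equiv.ext fun y => q.injective (by rw [ht, ht, hdot x x' h])
  have hπt (x y) : π (t x y) = π y := by
    have h1 := hπ x y
    rw [← ht, hq, hπ] at h1
    exact add_right_cancel h1
  have hπq (k : ℕ) (x) : π ((q ^ k) x) = π x + k :=
    apply_perm_pow_eq_add (fun x => by rw [hq, hπ]) k x
  -- After conjugation by `q`, the cycle set identity says that the displacements commute.
  have hcomm (x y) : t x * t y = t y * t x := by
    refine Equiv.ext fun w => q.injective (q.injective ?_)
    simp only [Equiv.Perm.mul_apply]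
    rw [htq x, htq y (t x w), ht y w, ht x w, ht, ht, hdot (q x) (dot y x) (by rw [hq, hπ, hπ]),
      hdot (q y) (dot x y) (by rw [hq, hπ, hπ]), dot_dot]
  have hqm (x) : q ^ m * t x = t x * q ^ m := by
    refine Equiv.ext fun y => ?_
    change (q ^ m) (t x y) = t x ((q ^ m) y)
    rw [perm_pow_map₂ (F := fun x y => t x y) htq, htπ ((q ^ m) x) x (by simp [hπq])]
  let K : Set (Equiv.Perm X) := insert (q ^ m) (Set.range t)
  have hK : ∀ x ∈ K, ∀ y ∈ K, x * y = y * x := by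
    rintro _ (rfl | ⟨x, rfl⟩) _ (rfl | ⟨y, rfl⟩)
    exacts [rfl, hqm y, (hqm x).symm, hcomm x y]
  have := Subgroup.isMulCommutative_closure hK
  have hN (n : Subgroup.closure K) (x) : π (n • x) = π x := by
    obtain ⟨n, hn⟩ := n
    change π (n x) = π x
    induction hn using Subgroup.closure_induction generalizing x with
    | mem n hn =>
      obtain rfl | ⟨y, rfl⟩ := hn
      exacts [by simp [hπq], hπt y x]
    | one => rfl
    | mul n n' _ _ h h' => rw [Equiv.Perm.mul_apply, h, h']
    | inv n _ h => exact (h (n⁻¹ x)).symm.trans (congrArg π (n.apply_symm_apply x))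
  obtain ⟨A, _, _, Φ, S, hΦ0, e, he⟩ := isomorphic_cyclicExt_of_mulAction hX hsurj hπ hdot q hq
    (N := Subgroup.closure K) hN
    (fun x => ⟨t x, Subgroup.subset_closure (Set.mem_insert_of_mem _ ⟨x, rfl⟩)⟩) ht htq
    ⟨q ^ m, Subgroup.subset_closure (Set.mem_insert _ _)⟩ fun _ => rfl
  refine ⟨A, _, _, Φ, S, ?_, hΦ0, e, he⟩
  -- For constant `Φ` all left translations would be equal.
  rintro ⟨c, hc⟩
  refine not_forall_dot_eq_of_level_two hl fun x y => funext fun w => e.injective ?_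
  rw [he, he, cyclicExt_dot, cyclicExt_dot, hc, hc]

end CycleSet

theorem mainTheorem7 (m : ℕ) [NeZero m] :
    (∀ (X : Type u) [CycleSet X],
      CycleSet.Indecomposable X →
      CycleSet.HasMultipermutationLevel X 2 →
      Nat.card (CycleSet.Ret X) = m →
      ∃ (A : Type u) (_ : AddCommGroup A) (_ : Finite A) (Φ : ZMod m → A) (S : A),
        (¬ ∃ c, ∀ i, Φ i = c) ∧ Φ 0 = 0 ∧
          CycleSet.Isomorphic X (CycleSet.CyclicExt m A Φ S)) ∧
    (∀ (A : Type v) [AddCommGroup A] [Finite A] (B : Type w) [AddCommGroup B] [Finite B]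
      (Φ : ZMod m → A) (S : A) (Φ' : ZMod m → B) (S' : B),
      (¬ ∃ c, ∀ i, Φ i = c) → Φ 0 = 0 →
      (¬ ∃ c, ∀ i, Φ' i = c) → Φ' 0 = 0 →
      CycleSet.Indecomposable (CycleSet.CyclicExt m A Φ S) →
      CycleSet.Indecomposable (CycleSet.CyclicExt m B Φ' S') →
      (CycleSet.Isomorphic (CycleSet.CyclicExt m A Φ S) (CycleSet.CyclicExt m B Φ' S') ↔
        ∃ f : A ≃+ B, Φ' = f ∘ Φ ∧ f S = S')) := by
  refine ⟨fun X _ hX hl hm => CycleSet.exists_isomorphic_cyclicExt hX hl hm, ?_⟩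
  intro A _ _ B _ _ Φ S Φ' S' hΦ hΦ0 _ hΦ'0 h _
  exact ⟨CycleSet.exists_addEquiv_of_isomorphic h hΦ hΦ0 hΦ'0,
    fun ⟨f, hf, hS⟩ => CycleSet.isomorphic_cyclicExt_of_addEquiv f hf hS⟩
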